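/- **Setting.** Let $C$ be a convex body in the plane (a nonempty compact convex set; its interior may be empty), given by a separation oracle: for a query $q\in\mathbb{R}^2$ the oracle either reports that $q\in C$, or returns, when $q\notin C$, a closed half-plane $h$ such that $q$ lies in the interior of $h$ and no point of $C$ does. Let $P$ be a finite set of $n$ points in the plane (in arbitrary position). A set $X$ is in *convex position* if every point of $X$ is a vertex (extreme point) of the convex hull $\mathrm{conv}(X)$, and $\mathrm{index}(P)$ is the size of the largest subset of $P$ in convex position. A *centerpoint* of a finite set $Q$ is a point $c\in\mathbb{R}^2$ such that every closed half-plane containing $c$ contains at least $|Q|/3$ points of $Q$. **Greedy algorithm.** Fix a constant $k\in\mathbb{N}$. The algorithm maintains an inner approximation $B$ (initially $\emptyset$) and the set $U$ of unclassified points (initially $P$). *Handling a query* $q$ means: if the oracle reports $q\in C$, replace $B$ by $\mathrm{conv}(B\cup\{q\})$, mark the points of $U\cap B$ as inside and delete them from $U$; if the oracle returns a half-plane $h$, mark the points of $U\cap\mathrm{int}(h)$ as outside and delete them from $U$. While $U\neq\emptyset$, a round is performed. If $B=\emptyset$, let $U^+=U$. Otherwise choose a line $\ell$ tangent to $B$ (a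 supporting line) that maximizes the number of points of $U$ lying strictly on the other side of $\ell$ than $B$, and let $U^+=U\cap\ell^+$, where $\ell^+$ is the closed half-plane bounded by $\ell$ on the side opposite to $B$. If $|U^+|\le k$, query the oracle at each point of $U^+$, in any order, and handle each query. If $|U^+|>k$, choose a centerpoint of $U^+$, query the oracle at it, and handle this query. **Theorem.** For every $k$ there is a constant $c=c(k)$ such that for all $P$, $C$ and every separation oracle for $C$ as above, and for all choices of tangent lines, centerpoints and query orders, the following holds. The algorithm can always perform its next round while $U\ne\emptyset$, and it terminates. When it terminates, the points marked as inside are exactly those of $P\cap C$, and the points marked as outside are exactly those of $P\setminus C$. If $n\ge 2$, the number of oracle queries is at most $c\,(\mathrm{index}(P)+1)\log n$. -/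

import Mathlib

namespace GreedyClassification

/-- The Euclidean plane. -/
abbrev Plane : Type := EuclideanSpace ℝ (Fin 2)

/-- A half-plane, given by a nonzero normal vector and an offset. The bounding line is
`{x | ⟪normal, x⟫ = offset}`. -/
structure HalfPlane where
  normal : Plane
  offset : ℝ
  normal_ne_zero : normal ≠ 0

namespace HalfPlane

/-- The closed half-plane. -/
def closedSide (h : HalfPlane) : Set Plane := {x | h.offset ≤ inner ℝ h.normal x}

/-- The open half-plane, i.e. the interior of the closed one. -/
def openSide (h : HalfPlane) : Set Plane := {x | h.offset < inner ℝ h.normal x}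

end HalfPlane

/-- A separation oracle for `C`: on a query `q` it reports `q ∈ C` (answer `none`), or it returns
a line separating `q` from `C`, as a proof that `q ∉ C`: `q` lies strictly on one side of the line
and no point of `C` does. -/
structure SeparationOracle (C : Set Plane) where
  answer : Plane → Option HalfPlane
  answer_of_mem : ∀ q ∈ C, answer q = none
  answer_of_notMem : ∀ q ∉ C, ∃ h : HalfPlane,
    answer q = some h ∧ q ∈ h.openSide ∧ Disjoint C h.openSide

/-- `X` is in convex position: every point of `X` is a vertex of the convex hull of `X`. -/
def InConvexPosition (X : Finset Plane) : Prop :=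
  (X : Set Plane) ⊆ (convexHull ℝ (X : Set Plane)).extremePoints ℝ

open Classical in
/-- The size of a largest subset of `P` in convex position. -/
noncomputable def index (P : Finset Plane) : ℕ :=
  (P.powerset.filter InConvexPosition).sup Finset.card

open Classical in
/-- `c` is a centerpoint of `Q`: every closed half-plane containing `c` contains at least a third
of the points of `Q`. -/
def IsCenterpoint (c : Plane) (Q : Finset Plane) : Prop :=
  ∀ h : HalfPlane, c ∈ h.closedSide →
    (Q.card : ℝ) / 3 ≤ ((Q.filter (· ∈ h.closedSide)).card : ℝ)

/-- The state of the greedy algorithm: the inner approximation, the unclassified points, the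
points marked as inside and as outside, and the number of oracle queries made so far. -/
structure State where
  inner : Set Plane
  unclassified : Finset Plane
  inside : Set Plane
  outside : Set Plane
  queries : ℕ

namespace State

/-- The initial state: the inner approximation is empty, and nothing is classified. -/
def initial (P : Finset Plane) : State where
  inner := ∅
  unclassified := P
  inside := ∅
  outside := ∅
  queries := 0

open Classical in
/-- Replace the inner approximation `B` by the convex hull of `B ∪ {p}`, and mark the newly
covered points as inside. -/
noncomputable def expand (s : State) (p : Plane) : State where
  inner := convexHull ℝ (insert p s.inner)
  unclassified := s.unclassified.filter (· ∉ convexHull ℝ (insert p s.inner))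
  inside := s.inside ∪ (↑s.unclassified ∩ convexHull ℝ (insert p s.inner))
  outside := s.outside
  queries := s.queries

open Classical in
/-- Mark the unclassified points in the interior of the half-plane `h` as outside. -/
noncomputable def remove (s : State) (h : HalfPlane) : State where
  inner := s.inner
  unclassified := s.unclassified.filter (· ∉ h.openSide)
  inside := s.inside
  outside := s.outside ∪ (↑s.unclassified ∩ h.openSide)
  queries := s.queries

/-- Query the oracle at `q` (this costs one query), and update according to the answer. -/
noncomputable def ask {C : Set Plane} (O : SeparationOracle C) (s : State) (q : Plane) : State :=
  match O.answer q with
  | none => { s.expand q with queries := s.queries + 1 }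
  | some h => { s.remove h with queries := s.queries + 1 }

end State

/-- The line bounding `h` is tangent to `B` (a supporting line of `B`), and `h` is the side of it
opposite to `B`. -/
def IsTangent (B : Set Plane) (h : HalfPlane) : Prop :=
  (∀ x ∈ B, inner ℝ h.normal x ≤ h.offset) ∧ ∃ x ∈ B, inner ℝ h.normal x = h.offset

open Classical in
/-- The number of points of `U` beyond the line bounding `h`. -/
noncomputable def numBeyond (U : Finset Plane) (h : HalfPlane) : ℕ :=
  (U.filter (· ∈ h.openSide)).card

/-- Among the lines tangent to `B`, the one bounding `h` has the largest number of points of `U`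
on the other side of it than `B`. -/
def IsGreedyTangent (B : Set Plane) (U : Finset Plane) (h : HalfPlane) : Prop :=
  IsTangent B h ∧ ∀ h' : HalfPlane, IsTangent B h' → numBeyond U h' ≤ numBeyond U h

open Classical in
/-- `Q` is a set of points that the algorithm may work on in the coming round: all unclassified
points if the inner approximation is empty, and otherwise the unclassified points in the closed
half-plane cut off by a tangent line chosen greedily. -/
def IsRoundSet (s : State) (Q : Finset Plane) : Prop :=
  (s.inner = ∅ ∧ Q = s.unclassified) ∨
  (s.inner.Nonempty ∧ ∃ h : HalfPlane, IsGreedyTangent s.inner s.unclassified h ∧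
    Q = s.unclassified.filter (· ∈ h.closedSide))

/-- One round of the greedy algorithm; rounds are performed as long as there are unclassified
points. If the round set `Q` has at most `k` points, then the oracle is queried at each of them
(in any order), otherwise it is queried at a centerpoint of `Q`. -/
inductive Round (k : ℕ) {C : Set Plane} (O : SeparationOracle C) : State → State → Prop
  | small (s : State) (Q : Finset Plane) (l : List Plane) (hU : s.unclassified.Nonempty)
      (hQ : IsRoundSet s Q) (hk : Q.card ≤ k) (hl : l.Nodup) (hlQ : ∀ p, p ∈ l ↔ p ∈ Q) :
      Round k O s (l.foldl (State.ask O) s)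
  | large (s : State) (Q : Finset Plane) (c : Plane) (hU : s.unclassified.Nonempty)
      (hQ : IsRoundSet s Q) (hk : k < Q.card) (hc : IsCenterpoint c Q) :
      Round k O s (State.ask O s c)

/-- The states that the algorithm can reach on the input `P`, for some choice of tangent lines,
centerpoints and orders. -/
def Reachable (k : ℕ) {C : Set Plane} (O : SeparationOracle C) (P : Finset Plane) (s : State) :
    Prop :=
  Relation.ReflTransGen (Round k O) (State.initial P) s

end GreedyClassification

namespace GreedyClassification

open Classical

/-! The potential of a state is the number of ordered pairs of unclassified points whose segment
misses the inner approximation `B`. It starts at no more than `n ^ 2`, is positive as long as a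
point is unclassified, and never increases. The claim is that a round with round set `Q` destroys at
least `|Q| ^ 2 / 144` pairs, while the potential is at most `16 * (index P + 1) * |Q| ^ 2`. So each
round multiplies it by at most `1 - 1 / (2304 * (index P + 1))`, and logarithms give the query
bound. The only exception is the single round in which `B` becomes nonempty.

Upper bound on the potential: by greediness, at most `M = |Q|` unclassified points can be separated
from `B` at once. Two points see each other only if one lies in a half-plane separating the other
from `B`, or if their line misses `B`; hence a set `W` has at most `4 * |W| * M` visible pairs
(`card_visiblePairs_le`). Low average visibility yields an independent set of size at least `|U| /
(4 * M)`, and independent sets are in convex position, so `|U| ≤ 4 * M * index P`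
(`card_le_mul_index`).

Progress: if the centerpoint `c` is outside `C`, at least a third of `Q` is removed. If it is
inside, `B` gains the segment from `c` to the point `b` where the tangent touches `B`, and this
segment blocks a constant fraction of the pairs in `Q` (`IsCenterpoint.sq_card_le`). -/

/-! ### Half-planes, separation and greedy tangents. -/

theorem inner_eq_coords (x y : Plane) : inner ℝ x y = x 0 * y 0 + x 1 * y 1 := by
  simp [PiLp.inner_apply, Fin.sum_univ_two, mul_comm]

theorem convex_setOf_inner_le (n : Plane) (r : ℝ) : Convex ℝ {x : Plane | inner ℝ n x ≤ r} :=
  convex_halfSpace_le (innerₛₗ ℝ n).isLinear r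

theorem convex_setOf_lt_inner (n : Plane) (r : ℝ) : Convex ℝ {x : Plane | r < inner ℝ n x} :=
  convex_halfSpace_gt (innerₛₗ ℝ n).isLinear r

/-- An open half-plane together with a point of its boundary is convex. -/
theorem convex_insert_setOf_inner_lt (n p : Plane) :
    Convex ℝ (insert p {x : Plane | inner ℝ n p < inner ℝ n x}) := by
  intro x hx y hy a b ha hb hab
  have key : ∀ (a b : ℝ) (y : Plane), 0 ≤ a → 0 ≤ b → a + b = 1 → inner ℝ n p < inner ℝ n y →
      a • p + b • y ∈ insert p {x : Plane | inner ℝ n p < inner ℝ n x} := by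
    intro a b y ha hb hab hy
    rcases hb.eq_or_lt with rfl | hb
    · left
      have : a = 1 := by linarith
      simp [this]
    · right
      have : inner ℝ n p = a * inner ℝ n p + b * inner ℝ n p := by rw [← add_mul, hab, one_mul]
      simp only [Set.mem_ofPred_eq, inner_add_right, inner_smul_right]
      nlinarith
  rcases hx with rfl | hx
  · rcases hy with rfl | hy
    · left
      rw [← add_smul, hab, one_smul]
    · exact key a b y ha hb hab hy
  · rcases hy with rfl | hy
    · rw [add_comm]
      exact key b a x hb ha (by linarith) hx
    · right
      exact convex_setOf_lt_inner n _ hx hy ha hb hab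

theorem exists_inner_lt_of_notMem {B : Set Plane} (hB : Convex ℝ B) (hB' : IsCompact B)
    {p : Plane} (hp : p ∉ B) : ∃ n : Plane, ∀ b ∈ B, inner ℝ n p < inner ℝ n b := by
  obtain ⟨f, u, hfp, hfB⟩ := geometric_hahn_banach_point_closed hB hB'.isClosed hp
  refine ⟨(InnerProductSpace.toDual ℝ Plane).symm f, fun b hb => ?_⟩
  rw [InnerProductSpace.toDual_symm_apply, InnerProductSpace.toDual_symm_apply]
  exact hfp.trans (hfB b hb)

/-- A set of points that can be separated from `B` is cut off by some tangent line, so it is no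
larger than what the greedy tangent line cuts off. -/
theorem card_le_numBeyond {B : Set Plane} (hB : Convex ℝ B) (hB' : IsCompact B)
    {U S : Finset Plane} {h : HalfPlane} (hh : IsGreedyTangent B U h)
    (hSU : S ⊆ U) (hS : Disjoint (convexHull ℝ (S : Set Plane)) B) :
    S.card ≤ numBeyond U h := by
  rcases S.eq_empty_or_nonempty with rfl | ⟨p, hp⟩
  · simp
  obtain ⟨b₀, hb₀, -⟩ := hh.1.2
  obtain ⟨f, u, v, hfB, huv, hfS⟩ := geometric_hahn_banach_compact_closed hB hB'
    (convex_convexHull ℝ (S : Set Plane))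
    (S.finite_toSet.isCompact_convexHull (𝕜 := ℝ)).isClosed hS.symm
  set n : Plane := (InnerProductSpace.toDual ℝ Plane).symm f with hn
  have hnf : ∀ x, inner ℝ n x = f x := fun x => InnerProductSpace.toDual_symm_apply
  have hn0 : n ≠ 0 := by
    intro h0
    have h1 := hfB b₀ hb₀
    have h2 := hfS p (subset_convexHull ℝ _ hp)
    rw [← hnf, h0, inner_zero_left] at h1 h2
    linarith
  -- The separating line is translated towards `B` until it touches `B`; it still cuts off all of
  -- `S`.
  obtain ⟨b, hb, hmax⟩ := hB'.exists_isMaxOn ⟨b₀, hb₀⟩ f.continuous.continuousOn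
  refine le_trans (Finset.card_le_card fun x hx => ?_)
    (hh.2 ⟨n, f b, hn0⟩ ⟨fun x hx => ?_, b, hb, ?_⟩)
  · rw [Finset.mem_filter]
    refine ⟨hSU hx, ?_⟩
    have := hfS x (subset_convexHull ℝ _ hx)
    have := hfB b hb
    change f b < inner ℝ n x
    rw [hnf]
    linarith
  · change inner ℝ n x ≤ f b
    rw [hnf]
    exact hmax hx
  · exact hnf b

/-- No unclassified point lies on a greedy tangent line. -/
theorem mem_openSide_of_isGreedyTangent {B : Set Plane} (hB : Convex ℝ B) (hB' : IsCompact B)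
    {U : Finset Plane} (hBU : ∀ p ∈ U, p ∉ B) {h : HalfPlane} (hh : IsGreedyTangent B U h)
    {p : Plane} (hpU : p ∈ U) (hp : p ∈ h.closedSide) : p ∈ h.openSide := by
  by_contra hpo
  have hoff : inner ℝ h.normal p = h.offset := le_antisymm (not_lt.1 hpo) hp
  have hsub : (convexHull ℝ ((insert p (U.filter (· ∈ h.openSide)) : Finset Plane) : Set Plane)) ⊆
      insert p {x : Plane | inner ℝ h.normal p < inner ℝ h.normal x} := by
    refine convexHull_min ?_ (convex_insert_setOf_inner_lt _ _)
    intro x hx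
    rw [Finset.mem_coe, Finset.mem_insert, Finset.mem_filter] at hx
    rcases hx with rfl | ⟨-, hx⟩
    · exact Or.inl rfl
    · right
      change inner ℝ h.normal p < inner ℝ h.normal x
      rw [hoff]
      exact hx
  -- With `p` added, the points strictly beyond the line can still be separated from `B`: one more
  -- than the greedy maximum.
  have := card_le_numBeyond hB hB' hh (S := insert p (U.filter (· ∈ h.openSide)))
    (by
      intro x hx
      rcases Finset.mem_insert.1 hx with rfl | hx
      · exact hpU
      · exact (Finset.mem_filter.1 hx).1)
    (by
      rw [Set.disjoint_left]
      intro x hx hxB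
      rcases hsub hx with rfl | hx
      · exact hBU _ hpU hxB
      · have := hh.1.1 x hxB
        have hx' : inner ℝ h.normal p < inner ℝ h.normal x := hx
        linarith)
  rw [Finset.card_insert_of_notMem (by simp [hpo])] at this
  unfold numBeyond at this
  omega

/-! ### Visibility -/

/-- `p` and `q` see each other past the obstacle `B`. -/
def Visible (B : Set Plane) (p q : Plane) : Prop := Disjoint (segment ℝ p q) B

theorem Visible.symm {B : Set Plane} {p q : Plane} (h : Visible B p q) : Visible B q p := by
  unfold Visible at *
  rwa [segment_symm]

theorem Visible.anti {B B' : Set Plane} (hB : B ⊆ B') {p q : Plane} (h : Visible B' p q) :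
    Visible B p q :=
  Disjoint.mono_right hB h

/-- The ordered pairs of points of `U` that see each other past `B`. -/
noncomputable def visiblePairs (B : Set Plane) (U : Finset Plane) : Finset (Plane × Plane) :=
  (U ×ˢ U).filter fun x => Visible B x.1 x.2

theorem visiblePairs_subset {B B' : Set Plane} {U U' : Finset Plane} (hB : B ⊆ B') (hU : U' ⊆ U) :
    visiblePairs B' U' ⊆ visiblePairs B U := by
  intro x hx
  simp only [visiblePairs, Finset.mem_filter, Finset.mem_product] at hx ⊢
  exact ⟨⟨hU hx.1.1, hU hx.1.2⟩, hx.2.anti hB⟩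

/-- The diagonal pairs suffice. Counting them keeps the potential positive while any point is
unclassified. -/
theorem card_le_card_visiblePairs {B : Set Plane} {U : Finset Plane} (h : ∀ p ∈ U, p ∉ B) :
    U.card ≤ (visiblePairs B U).card := by
  refine Finset.card_le_card_of_injOn (fun p => (p, p)) (fun p hp => ?_) (fun p _ q _ h => ?_)
  · simp only [visiblePairs, Finset.coe_filter, Finset.mem_product, Set.mem_ofPred_eq]
    refine ⟨⟨hp, hp⟩, ?_⟩
    simpa [Visible] using h p hp
  · exact (Prod.ext_iff.1 h).1

/-! ### Upper bound on the number of visible pairs. -/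

theorem card_filter_product_le {α : Type*} (W : Finset α) (r : α → α → Prop) (M : ℕ)
    (h : ∀ p ∈ W, (W.filter (r p)).card ≤ M) :
    ((W ×ˢ W).filter fun x => r x.1 x.2).card ≤ W.card * M := by
  rw [Finset.card_filter, Finset.sum_product, ← smul_eq_mul]
  refine Finset.sum_le_card_nsmul _ _ _ fun p hp => ?_
  rw [← Finset.card_filter]
  exact h p hp

theorem card_filter_product_le' {α : Type*} (W : Finset α) (r : α → α → Prop) (M : ℕ)
    (h : ∀ p ∈ W, (W.filter (r p)).card ≤ M) :
    ((W ×ˢ W).filter fun x => r x.2 x.1).card ≤ W.card * M := by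
  rw [Finset.card_filter, Finset.sum_product_right, ← smul_eq_mul]
  refine Finset.sum_le_card_nsmul _ _ _ fun p hp => ?_
  rw [← Finset.card_filter]
  exact h p hp

/-- The orientation of the triangle `p q x`. -/
def cross (p q x : Plane) : ℝ := (q 0 - p 0) * (x 1 - p 1) - (q 1 - p 1) * (x 0 - p 0)

theorem exists_lineMap_of_cross_eq_zero {p q b : Plane} (hpq : p ≠ q) (h : cross p q b = 0) :
    ∃ t : ℝ, b = (1 - t) • p + t • q := by
  unfold cross at h
  by_cases h0 : q 0 - p 0 = 0
  · have h1 : q 1 - p 1 ≠ 0 := by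
      intro h1
      apply hpq
      ext i
      fin_cases i
      · exact (sub_eq_zero.1 h0).symm
      · exact (sub_eq_zero.1 h1).symm
    refine ⟨(b 1 - p 1) / (q 1 - p 1), ?_⟩
    ext i
    fin_cases i
    · simp [h0, h1] at h ⊢
      field_simp
      linear_combination (q 1 - p 1) * h - (b 1 - p 1) * h0
    · simp
      field_simp
      ring
  · refine ⟨(b 0 - p 0) / (q 0 - p 0), ?_⟩
    ext i
    fin_cases i
    · simp
      field_simp
      ring
    · simp
      field_simp
      linear_combination h

theorem cross_combo (p q x y : Plane) {a b : ℝ} (hab : a + b = 1) :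
    cross p q (a • x + b • y) = a * cross p q x + b * cross p q y := by
  obtain rfl : a = 1 - b := by linarith
  simp [cross]
  ring

theorem convex_setOf_cross_pos (p b : Plane) : Convex ℝ {x : Plane | 0 < cross p b x} := by
  intro x hx y hy s t hs ht hst
  simp only [Set.mem_ofPred_eq] at *
  rw [cross_combo _ _ _ _ hst]
  rcases hs.eq_or_lt with rfl | hs
  · have : t = 1 := by linarith
    simpa [this] using hy
  · have := mul_pos hs hx
    have := mul_nonneg ht hy.le
    linarith

theorem cross_swap (p q x : Plane) : cross p x q = -cross p q x := by
  unfold cross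
  ring

theorem convex_setOf_cross_neg (p b : Plane) : Convex ℝ {x : Plane | cross p b x < 0} := by
  intro x hx y hy s t hs ht hst
  simp only [Set.mem_ofPred_eq] at *
  rw [cross_combo _ _ _ _ hst]
  rcases hs.eq_or_lt with rfl | hs
  · have : t = 1 := by linarith
    simpa [this] using hy
  · have := mul_neg_of_pos_of_neg hs hx
    have := mul_nonpos_of_nonneg_of_nonpos ht hy.le
    linarith

/-- If `p` and `q` see each other, then the line through them misses `B`, or meets it beyond one of
them; in the latter case that point lies between the other one and `B`. -/
theorem Visible.cases {B : Set Plane} (hB : Convex ℝ B) {p q : Plane} (h : Visible B p q)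
    {g : Plane → Plane} (hp : ∀ b ∈ B, inner ℝ (g p) p < inner ℝ (g p) b)
    (hq : ∀ b ∈ B, inner ℝ (g q) q < inner ℝ (g q) b) :
    inner ℝ (g p) q ≤ inner ℝ (g p) p ∨ inner ℝ (g q) p ≤ inner ℝ (g q) q ∨
      (∀ b ∈ B, 0 < cross p q b) ∨ ∀ b ∈ B, cross p q b < 0 := by
  by_cases hpq : p = q
  · left
    rw [hpq]
  by_contra! hcon
  obtain ⟨h1, h2, ⟨x, hx, hx0⟩, y, hy, hy0⟩ := hcon
  -- Intermediate value: `cross p q` is affine and changes sign on `B`, so it vanishes at an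
  -- explicit convex combination of `x` and `y`.
  obtain ⟨b, hb, hb0⟩ : ∃ b ∈ B, cross p q b = 0 := by
    by_cases hxy : cross p q y - cross p q x = 0
    · exact ⟨x, hx, by linarith⟩
    · have hpos : 0 < cross p q y - cross p q x := lt_of_le_of_ne (by linarith) (Ne.symm hxy)
      have hsum : cross p q y / (cross p q y - cross p q x) +
          -cross p q x / (cross p q y - cross p q x) = 1 := by
        field_simp
        ring
      refine ⟨_, hB hx hy (div_nonneg hy0 hpos.le)
        (div_nonneg (neg_nonneg.2 hx0) hpos.le) hsum, ?_⟩
      rw [cross_combo _ _ _ _ hsum]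
      field_simp
      ring
  obtain ⟨t, ht⟩ := exists_lineMap_of_cross_eq_zero hpq hb0
  have hbp := hp b hb
  have hbq := hq b hb
  rw [ht, inner_add_right, inner_smul_right, inner_smul_right] at hbp hbq
  -- If `t < 0`, then `p` lies between `b` and `q`, and `g p`, which increases from `p` to `b`,
  -- cannot also increase from `p` to `q`. The case `t > 1` is symmetric.
  have ht0 : 0 ≤ t := by
    by_contra! ht0
    nlinarith
  have ht1 : t ≤ 1 := by
    by_contra! ht1
    nlinarith
  refine Set.disjoint_left.1 h ?_ hb
  rw [ht]
  exact ⟨1 - t, t, by linarith, ht0, by ring, rfl⟩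

/-- If at most `M` points of `U` can be separated from `B` by one line, then few pairs of points
see each other. -/
theorem card_visiblePairs_le {B : Set Plane} (hB : Convex ℝ B) (hB' : IsCompact B)
    (hB0 : B.Nonempty) {W : Finset Plane} (hBW : ∀ p ∈ W, p ∉ B) {M : ℕ}
    (hM : ∀ S ⊆ W, Disjoint (convexHull ℝ (S : Set Plane)) B → S.card ≤ M) :
    (visiblePairs B W).card ≤ 4 * (W.card * M) := by
  obtain ⟨b₀, hb₀⟩ := hB0
  choose! g hg using fun p (hp : p ∉ B) => exists_inner_lt_of_notMem hB hB' hp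
  -- Each kind of visibility from a fixed `p` confines `q` to a convex set missing `B`, so `hM`
  -- bounds the number of such `q`.
  have key : ∀ (r : Plane → Plane → Prop),
      (∀ p ∈ W, ∃ K : Set Plane, Convex ℝ K ∧ Disjoint K B ∧ ∀ q, r p q → q ∈ K) →
      ∀ p ∈ W, (W.filter (r p)).card ≤ M := by
    intro r hr p hp
    obtain ⟨K, hK, hKB, hrK⟩ := hr p hp
    refine hM _ (Finset.filter_subset _ _) (hKB.mono_left (convexHull_min ?_ hK))
    intro q hq
    exact hrK q (Finset.mem_filter.1 hq).2
  have k1 := key (fun p q => inner ℝ (g p) q ≤ inner ℝ (g p) p) fun p hp =>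
    ⟨_, convex_setOf_inner_le (g p) (inner ℝ (g p) p),
      Set.disjoint_left.2 fun x hx hxB => (hg p (hBW p hp) x hxB).not_ge hx, fun q hq => hq⟩
  -- The set is an intersection of half-planes with boundary through `p` and `b`; it misses `B`
  -- because `cross p x x = 0`.
  have k2 := key (fun p q => ∀ b ∈ B, 0 < cross p q b) fun p hp =>
    ⟨{x | ∀ b ∈ B, 0 < cross p x b}, by
      have : {x | ∀ b ∈ B, 0 < cross p x b} = ⋂ b ∈ B, {x | cross p b x < 0} := by
        ext x
        simp only [Set.mem_ofPred_eq, Set.mem_iInter]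
        refine forall₂_congr fun b _ => ?_
        rw [cross_swap p b x]
        constructor <;> intro h <;> linarith
      rw [this]
      exact convex_iInter₂ fun b _ => convex_setOf_cross_neg p b,
      Set.disjoint_left.2 fun x hx hxB => by
        have := hx x hxB
        simp [cross, mul_comm] at this, fun q hq => hq⟩
  have k3 := key (fun p q => ∀ b ∈ B, cross p q b < 0) fun p hp =>
    ⟨{x | ∀ b ∈ B, cross p x b < 0}, by
      have : {x | ∀ b ∈ B, cross p x b < 0} = ⋂ b ∈ B, {x | 0 < cross p b x} := by
        ext x
        simp only [Set.mem_ofPred_eq, Set.mem_iInter]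
        refine forall₂_congr fun b _ => ?_
        rw [cross_swap p b x]
        constructor <;> intro h <;> linarith
      rw [this]
      exact convex_iInter₂ fun b _ => convex_setOf_cross_pos p b,
      Set.disjoint_left.2 fun x hx hxB => by
        have := hx x hxB
        simp [cross, mul_comm] at this, fun q hq => hq⟩
  have c1 := card_filter_product_le W _ M k1
  have c1' := card_filter_product_le' W _ M k1
  have c2 := card_filter_product_le W _ M k2
  have c3 := card_filter_product_le W _ M k3
  refine (Finset.card_le_card (t := (((W ×ˢ W).filter
    fun x => inner ℝ (g x.1) x.2 ≤ inner ℝ (g x.1) x.1) ∪ ((W ×ˢ W).filter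
    fun x => inner ℝ (g x.2) x.1 ≤ inner ℝ (g x.2) x.2)) ∪ (((W ×ˢ W).filter
    fun x => ∀ b ∈ B, 0 < cross x.1 x.2 b) ∪ ((W ×ˢ W).filter
    fun x => ∀ b ∈ B, cross x.1 x.2 b < 0))) ?_).trans ?_
  · intro x hx
    simp only [visiblePairs, Finset.mem_filter, Finset.mem_union] at hx ⊢
    have hx' := Finset.mem_product.1 hx.1
    have := hx.2.cases hB (g := g) (hg _ (hBW _ hx'.1)) (hg _ (hBW _ hx'.2))
    tauto
  · refine (Finset.card_union_le _ _).trans ?_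
    have u1 := Finset.card_union_le ((W ×ˢ W).filter
      fun x => inner ℝ (g x.1) x.2 ≤ inner ℝ (g x.1) x.1) ((W ×ˢ W).filter
      fun x => inner ℝ (g x.2) x.1 ≤ inner ℝ (g x.2) x.2)
    have u2 := Finset.card_union_le ((W ×ˢ W).filter
      fun x => ∀ b ∈ B, 0 < cross x.1 x.2 b) ((W ×ˢ W).filter
      fun x => ∀ b ∈ B, cross x.1 x.2 b < 0)
    omega

/-! ### Independent sets of the visibility graph and the index. -/

/-- Greedy independent sets: if every nonempty set of vertices has a vertex of degree less than
`D` within the set, then there is a large independent set. -/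
theorem exists_independent {α : Type*} (r : α → α → Prop) (hs : ∀ p q, r p q → r q p) (D : ℕ)
    (U : Finset α) (hr : ∀ p ∈ U, r p p)
    (h : ∀ W ⊆ U, W.Nonempty → ∃ p ∈ W, (W.filter (r p)).card ≤ D) :
    ∃ I ⊆ U, (∀ p ∈ I, ∀ q ∈ I, p ≠ q → ¬ r p q) ∧ U.card ≤ D * I.card := by
  induction U using Finset.strongInduction with
  | H U ih =>
    rcases U.eq_empty_or_nonempty with rfl | hU
    · exact ⟨∅, by simp⟩
    obtain ⟨p, hp, hpD⟩ := h U subset_rfl hU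
    -- The chosen `p` is discarded with its neighbours. Since `r` is reflexive, the `D` elements
    -- allowed for include `p` itself.
    have hsub : U.filter (fun q => ¬ r p q) ⊂ U := by
      rw [Finset.filter_ssubset]
      exact ⟨p, hp, not_not.2 (hr p hp)⟩
    obtain ⟨I, hIU, hI, hc⟩ := ih _ hsub (fun q hq => hr q (hsub.1 hq))
      (fun W hW => h W (hW.trans hsub.1))
    have hpI : ∀ q ∈ I, ¬ r p q := fun q hq => (Finset.mem_filter.1 (hIU hq)).2
    refine ⟨insert p I, ?_, ?_, ?_⟩
    · exact Finset.insert_subset hp (hIU.trans hsub.1)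
    · intro x hx y hy hxy
      rcases Finset.mem_insert.1 hx with rfl | hxI
      · rcases Finset.mem_insert.1 hy with rfl | hyI
        · exact absurd rfl hxy
        · exact hpI y hyI
      · rcases Finset.mem_insert.1 hy with rfl | hyI
        · exact fun h => hpI x hxI (hs _ _ h)
        · exact hI x hxI y hyI hxy
    · rw [Finset.card_insert_of_notMem fun hpI' => hpI p hpI' (hr p hp), mul_add, mul_one]
      have := Finset.card_filter_add_card_filter_not (s := U) (r p)
      omega

/-- Points outside `B` that do not see each other past `B` are in convex position. -/
theorem inConvexPosition_of_not_visible {B : Set Plane} (hB : Convex ℝ B) (hB' : IsCompact B)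
    {I : Finset Plane} (hI : ∀ p ∈ I, p ∉ B) (hv : ∀ p ∈ I, ∀ q ∈ I, p ≠ q → ¬ Visible B p q) :
    InConvexPosition I := by
  intro p hp
  obtain ⟨n, hn⟩ := exists_inner_lt_of_notMem hB hB' (hI p hp)
  have hsub : convexHull ℝ (I : Set Plane) ⊆ insert p {x : Plane | inner ℝ n p < inner ℝ n x} := by
    refine convexHull_min (fun q hq => ?_) (convex_insert_setOf_inner_lt n p)
    by_cases hpq : p = q
    · exact Or.inl hpq.symm
    right
    -- The segment from `p` to `q` meets `B`, where `n` exceeds its value at `p`; by affinity `n` is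
    -- larger at `q` too.
    obtain ⟨b, ⟨s, t, hs, ht, hst, hb⟩, hbB⟩ := Set.not_disjoint_iff.1 (hv p hp q hq hpq)
    have hb' := hn b hbB
    rw [← hb, inner_add_right, inner_smul_right, inner_smul_right] at hb'
    obtain rfl : s = 1 - t := by linarith
    change inner ℝ n p < inner ℝ n q
    by_contra! hcon
    nlinarith
  rw [mem_extremePoints_iff_left]
  refine ⟨subset_convexHull ℝ _ hp, fun x hx y hy ⟨s, t, hs, ht, hst, hxy⟩ => ?_⟩
  rcases hsub hx with h | h
  · exact h
  exfalso
  have h' : inner ℝ n p < inner ℝ n x := h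
  have hy' : inner ℝ n p ≤ inner ℝ n y := by
    rcases hsub hy with rfl | h
    · exact le_rfl
    · exact le_of_lt h
  have := congrArg (inner ℝ n) hxy
  rw [inner_add_right, inner_smul_right, inner_smul_right] at this
  obtain rfl : s = 1 - t := by linarith
  nlinarith

theorem card_le_index {P I : Finset Plane} (hI : I ⊆ P) (h : InConvexPosition I) :
    I.card ≤ index P :=
  Finset.le_sup (f := Finset.card) (Finset.mem_filter.2 ⟨Finset.mem_powerset.2 hI, h⟩)

/-- By averaging, every nonempty `W ⊆ U` has a point that sees at most `4 * M` points of `W`. The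
resulting independent set has at least `|U| / (4 * M)` points and is in convex position. -/
theorem card_le_mul_index {B : Set Plane} (hB : Convex ℝ B) (hB' : IsCompact B)
    (hB0 : B.Nonempty) {P U : Finset Plane} (hUP : U ⊆ P) (hBU : ∀ p ∈ U, p ∉ B) {M : ℕ}
    (hM : ∀ S ⊆ U, Disjoint (convexHull ℝ (S : Set Plane)) B → S.card ≤ M) :
    U.card ≤ 4 * M * index P := by
  obtain ⟨I, hIU, hI, hc⟩ := exists_independent (Visible B) (fun _ _ h => h.symm) (4 * M) U
    (fun p hp => by simpa [Visible] using hBU p hp) (fun W hW hW0 => by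
      have h := card_visiblePairs_le hB hB' hB0 (fun p hp => hBU p (hW hp))
        (fun S hS => hM S (hS.trans hW))
      rw [visiblePairs, Finset.card_filter, Finset.sum_product] at h
      refine Finset.exists_le_of_sum_le (g := fun _ => 4 * M) hW0 ?_
      simp only [Finset.card_filter, Finset.sum_const, smul_eq_mul]
      linarith)
  refine hc.trans (Nat.mul_le_mul_left _ (card_le_index (hIU.trans hUP) ?_))
  exact inConvexPosition_of_not_visible hB hB' (fun p hp => hBU p (hIU hp)) hI

/-! ### Centerpoints. -/

/-- Helly's theorem for the hulls of all subsets containing more than two thirds of `Q`. A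
half-plane through a common point `c` with fewer than a third of `Q` would leave such a subset in
its complement, whose hull misses `c`. -/
theorem exists_isCenterpoint (Q : Finset Plane) : ∃ c, IsCenterpoint c Q := by
  set F : Finset (Finset Plane) := Q.powerset.filter fun S => 2 * Q.card < 3 * S.card with hF
  have hne : (⋂ S ∈ F, convexHull ℝ (S : Set Plane)).Nonempty := by
    refine Convex.helly_theorem' (𝕜 := ℝ) (fun S _ => convex_convexHull ℝ _) fun G hG hcard => ?_
    rw [finrank_euclideanSpace_fin] at hcard
    rcases G.eq_empty_or_nonempty with rfl | hG0
    · simp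
    have hbound : ∀ S ∈ G, S ⊆ Q ∧ 3 * (Q \ S).card < Q.card := by
      intro S hS
      obtain ⟨hSQ, hSc⟩ := Finset.mem_filter.1 (hG hS)
      have hSQ := Finset.mem_powerset.1 hSQ
      have := Finset.card_sdiff_add_card_eq_card hSQ
      exact ⟨hSQ, by omega⟩
    -- At most three members, each missing less than a third of `Q`, cannot together miss all of it.
    have hlt : (G.biUnion fun S => Q \ S).card < Q.card := by
      have h1 : 3 * (G.biUnion fun S => Q \ S).card ≤ ∑ S ∈ G, 3 * (Q \ S).card := by
        rw [← Finset.mul_sum]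
        exact Nat.mul_le_mul_left _ Finset.card_biUnion_le
      have h2 : ∑ S ∈ G, 3 * (Q \ S).card < ∑ _S ∈ G, Q.card :=
        Finset.sum_lt_sum_of_nonempty hG0 fun S hS => (hbound S hS).2
      rw [Finset.sum_const, smul_eq_mul] at h2
      have h3 : G.card * Q.card ≤ 3 * Q.card := Nat.mul_le_mul_right _ hcard
      omega
    obtain ⟨x, hxQ, hx⟩ := Finset.exists_mem_notMem_of_card_lt_card hlt
    refine ⟨x, Set.mem_iInter₂.2 fun S hS => subset_convexHull ℝ _ ?_⟩
    by_contra hxS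
    exact hx (Finset.mem_biUnion.2 ⟨S, hS, Finset.mem_sdiff.2 ⟨hxQ, hxS⟩⟩)
  obtain ⟨c, hc⟩ := hne
  refine ⟨c, fun h hch => ?_⟩
  by_contra! hlt
  have hsplit := Finset.card_filter_add_card_filter_not (s := Q) (· ∈ h.closedSide)
  have hmem : Q.filter (· ∉ h.closedSide) ∈ F := by
    rw [hF, Finset.mem_filter, Finset.mem_powerset]
    refine ⟨Finset.filter_subset _ _, ?_⟩
    have hlt' : 3 * (Q.filter (· ∈ h.closedSide)).card < Q.card := by
      have : (3 : ℝ) * (Q.filter (· ∈ h.closedSide)).card < Q.card := by linarith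
      exact_mod_cast this
    omega
  have hcS := Set.mem_iInter₂.1 hc _ hmem
  have hconv : Convex ℝ {x : Plane | inner ℝ h.normal x < h.offset} :=
    convex_halfSpace_lt (innerₛₗ ℝ h.normal).isLinear h.offset
  have hsub := convexHull_min (fun x hx => ?_) hconv hcS
  · have h1 : inner ℝ h.normal c < h.offset := hsub
    have h2 : h.offset ≤ inner ℝ h.normal c := hch
    exact h1.not_ge h2
  · have hx' : ¬ h.offset ≤ inner ℝ h.normal x := (Finset.mem_filter.1 hx).2
    exact not_le.1 hx'

theorem IsCenterpoint.card_le_of_mem_openSide {c : Plane} {Q : Finset Plane}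
    (hc : IsCenterpoint c Q) {h : HalfPlane} (hch : c ∈ h.openSide) :
    Q.card ≤ 3 * (Q.filter (· ∈ h.openSide)).card := by
  have key := hc ⟨h.normal, inner ℝ h.normal c, h.normal_ne_zero⟩ (le_refl (inner ℝ h.normal c))
  have hle : (Q.filter (· ∈ (HalfPlane.mk h.normal (inner ℝ h.normal c)
      h.normal_ne_zero).closedSide)).card ≤ (Q.filter (· ∈ h.openSide)).card := by
    refine Finset.card_le_card fun x hx => ?_
    obtain ⟨hxQ, hx⟩ := Finset.mem_filter.1 hx
    have h1 : inner ℝ h.normal c ≤ inner ℝ h.normal x := hx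
    have h2 : h.offset < inner ℝ h.normal c := hch
    exact Finset.mem_filter.2 ⟨hxQ, lt_of_lt_of_le h2 h1⟩
  have hle' : ((Q.filter (· ∈ (HalfPlane.mk h.normal (inner ℝ h.normal c)
      h.normal_ne_zero).closedSide)).card : ℝ) ≤ (Q.filter (· ∈ h.openSide)).card :=
    Nat.cast_le.2 hle
  have : (Q.card : ℝ) ≤ 3 * (Q.filter (· ∈ h.openSide)).card := by linarith
  exact_mod_cast this

/-- If every threshold has at least `T` elements of `R` above or of `L` below it, then there are
many pairs in `L × R` in the wrong order. -/
theorem sq_le_card_filter_le {α : Type*} (R L : Finset α) (f : α → ℝ) {T : ℝ} (hT : 0 < T)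
    (h : ∀ s : ℝ, T ≤ (R.filter (s ≤ f ·)).card + (L.filter (f · ≤ s)).card) :
    T ^ 2 ≤ 4 * ((R ×ˢ L).filter fun x => f x.2 ≤ f x.1).card := by
  obtain ⟨s, hsR, hsL⟩ : ∃ s : ℝ, T / 2 ≤ (R.filter (s ≤ f ·)).card ∧
      T / 2 ≤ (L.filter (f · ≤ s)).card := by
    -- The threshold is the largest value of `f` on `R` that still has `T / 2` elements of `R` at or
    -- above it.
    set G := R.filter fun r => T / 2 ≤ (R.filter (f r ≤ f ·)).card with hG
    have hlift : ∀ s : ℝ, T / 2 ≤ (R.filter (s ≤ f ·)).card → ∃ r ∈ G, s ≤ f r := by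
      intro s hs
      have hpos : 0 < (R.filter (s ≤ f ·)).card := by
        have : (0 : ℝ) < (R.filter (s ≤ f ·)).card := by linarith
        exact_mod_cast this
      obtain ⟨r, hr, hmin⟩ := Finset.exists_min_image _ f (Finset.card_pos.1 hpos)
      obtain ⟨hrR, hsr⟩ := Finset.mem_filter.1 hr
      refine ⟨r, Finset.mem_filter.2 ⟨hrR, hs.trans (Nat.cast_le.2 (Finset.card_le_card ?_))⟩, hsr⟩
      intro x hx
      exact Finset.mem_filter.2 ⟨(Finset.mem_filter.1 hx).1, hmin x hx⟩
    have hG0 : G.Nonempty := by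
      have hev : ∀ᶠ s : ℝ in Filter.atBot, ∀ l ∈ L, s < f l :=
        (Finset.eventually_all L).2 fun l _ => Filter.eventually_lt_atBot (f l)
      obtain ⟨s, hs⟩ := hev.exists
      have h0 : L.filter (f · ≤ s) = ∅ :=
        Finset.filter_eq_empty_iff.2 fun l hl => not_le.2 (hs l hl)
      have := h s
      rw [h0, Finset.card_empty, Nat.cast_zero, add_zero] at this
      obtain ⟨r, hr, -⟩ := hlift s (by linarith)
      exact ⟨r, hr⟩
    obtain ⟨r, hr, hmax⟩ := Finset.exists_max_image G f hG0
    refine ⟨f r, (Finset.mem_filter.1 hr).2, ?_⟩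
    -- Slightly above `f r` no new element of `L` is counted, but fewer than `T / 2` elements of `R`
    -- remain; so `L` supplies the other half.
    have hev : ∀ᶠ s : ℝ in nhdsWithin (f r) (Set.Ioi (f r)), ∀ l ∈ L, f l ≤ s → f l ≤ f r := by
      refine (Finset.eventually_all L).2 fun l _ => ?_
      rcases le_or_gt (f l) (f r) with hl | hl
      · exact Filter.Eventually.of_forall fun _ _ => hl
      · filter_upwards [nhdsWithin_le_nhds (Iio_mem_nhds hl)] with s hs hs'
        exact absurd hs' (not_le.2 hs)
    obtain ⟨s, hs, hrs⟩ := (hev.and self_mem_nhdsWithin).exists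
    have hsmall : ((R.filter (s ≤ f ·)).card : ℝ) < T / 2 := by
      by_contra! hcon
      obtain ⟨r', hr', hsr'⟩ := hlift s hcon
      exact absurd (hmax r' hr') (not_le.2 (lt_of_lt_of_le hrs hsr'))
    have hle : ((L.filter (f · ≤ s)).card : ℝ) ≤ (L.filter (f · ≤ f r)).card := by
      refine Nat.cast_le.2 (Finset.card_le_card fun l hl => ?_)
      obtain ⟨hl, hls⟩ := Finset.mem_filter.1 hl
      exact Finset.mem_filter.2 ⟨hl, hs l hl hls⟩
    have := h s
    linarith
  have hsub : (R.filter (s ≤ f ·)) ×ˢ (L.filter (f · ≤ s)) ⊆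
      (R ×ˢ L).filter fun x => f x.2 ≤ f x.1 := by
    intro x hx
    simp only [Finset.mem_product, Finset.mem_filter] at hx ⊢
    exact ⟨⟨hx.1.1, hx.2.1⟩, hx.2.2.trans hx.1.2⟩
  have hcard := Finset.card_le_card hsub
  rw [Finset.card_product] at hcard
  have hcard' : ((R.filter (s ≤ f ·)).card : ℝ) * (L.filter (f · ≤ s)).card ≤
      ((R ×ˢ L).filter fun x => f x.2 ≤ f x.1).card := by exact_mod_cast hcard
  nlinarith [mul_le_mul hsR hsL (by linarith) (by linarith)]

/-! ### Segments crossing the segment from a centerpoint to `B`. -/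

/-- The coordinate of `x` along the axis from `c` to `b`. -/
def along (c b x : Plane) : ℝ := (b 0 - c 0) * (x 0 - c 0) + (b 1 - c 1) * (x 1 - c 1)

theorem along_combo (p q x y : Plane) {a b : ℝ} (hab : a + b = 1) :
    along p q (a • x + b • y) = a * along p q x + b * along p q y := by
  obtain rfl : a = 1 - b := by linarith
  simp [along]
  ring

/-- The sign of `along` puts `z` on the ray from `c` towards `b`, and `hbz` keeps it from passing
`b`. -/
theorem mem_segment_of_cross_eq_zero {b c n z : Plane} (hbc : inner ℝ n b < inner ℝ n c)
    (hbz : inner ℝ n b < inner ℝ n z) (h0 : cross c b z = 0) (h1 : 0 ≤ along c b z) :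
    z ∈ segment ℝ c b := by
  have hne : c ≠ b := by
    rintro rfl
    exact lt_irrefl _ hbc
  obtain ⟨t, rfl⟩ := exists_lineMap_of_cross_eq_zero hne h0
  rw [inner_add_right, inner_smul_right, inner_smul_right] at hbz
  have ht1 : t < 1 := by
    by_contra! hcon
    nlinarith
  have hpos : 0 < along c b b := by
    unfold along
    have : b 0 - c 0 ≠ 0 ∨ b 1 - c 1 ≠ 0 := by
      by_contra! hcon
      apply hne
      ext i
      fin_cases i
      · exact (sub_eq_zero.1 hcon.1).symm
      · exact (sub_eq_zero.1 hcon.2).symm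
    rcases this with h | h
    · have := mul_self_pos.2 h
      nlinarith [mul_self_nonneg (b 1 - c 1)]
    · have := mul_self_pos.2 h
      nlinarith [mul_self_nonneg (b 0 - c 0)]
  have hc0 : along c b c = 0 := by simp [along]
  rw [along_combo _ _ _ _ (by ring), hc0, mul_zero, zero_add] at h1
  have ht0 : 0 ≤ t := by
    by_contra! hcon
    nlinarith
  exact ⟨1 - t, t, by linarith, ht0, by ring, rfl⟩

/-- The segment from `p` to `q` crosses the axis at an explicit convex combination; `h`, with
denominators of opposite sign, says that `along` is nonnegative there. -/
theorem segments_meet {b c n p q : Plane} (hbc : inner ℝ n b < inner ℝ n c)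
    (hbp : inner ℝ n b < inner ℝ n p) (hbq : inner ℝ n b < inner ℝ n q)
    (hp : 0 < cross c b p) (hq : cross c b q < 0)
    (h : along c b q / cross c b q ≤ along c b p / cross c b p) :
    ∃ z ∈ segment ℝ p q, z ∈ segment ℝ c b := by
  have hpos : 0 < cross c b p - cross c b q := by linarith
  have hu : 0 ≤ -cross c b q / (cross c b p - cross c b q) := div_nonneg (by linarith) hpos.le
  have hv : 0 ≤ cross c b p / (cross c b p - cross c b q) := div_nonneg hp.le hpos.le
  have huv : -cross c b q / (cross c b p - cross c b q) +
      cross c b p / (cross c b p - cross c b q) = 1 := by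
    field_simp
    ring
  have hmem : (-cross c b q / (cross c b p - cross c b q)) • p +
      (cross c b p / (cross c b p - cross c b q)) • q ∈ segment ℝ p q :=
    ⟨_, _, hu, hv, huv, rfl⟩
  refine ⟨_, hmem, mem_segment_of_cross_eq_zero hbc ?_ ?_ ?_⟩
  · exact (convex_setOf_lt_inner n (inner ℝ n b)).segment_subset hbp hbq hmem
  · rw [cross_combo _ _ _ _ huv]
    field_simp
    ring
  · rw [along_combo _ _ _ _ huv]
    have h' : along c b p * cross c b q ≤ along c b q * cross c b p := by
      have e1 : along c b q / cross c b q * (cross c b q * cross c b p) =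
          along c b q * cross c b p := by
        rw [← mul_assoc, div_mul_cancel₀ _ hq.ne]
      have e2 : along c b p / cross c b p * (cross c b q * cross c b p) =
          along c b p * cross c b q := by field_simp
      rw [← e1, ← e2]
      exact mul_le_mul_of_nonpos_right h (mul_nonpos_of_nonpos_of_nonneg hq.le hp.le)
    have : -cross c b q / (cross c b p - cross c b q) * along c b p +
        cross c b p / (cross c b p - cross c b q) * along c b q =
        (along c b q * cross c b p - along c b p * cross c b q) / (cross c b p - cross c b q) := by
      field_simp
      ring
    rw [this]
    exact div_nonneg (by linarith) hpos.le

/-- The segment from a centerpoint of `Q` to a point beyond `Q` is crossed by a constant fraction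
of the segments between points of `Q`. -/
theorem IsCenterpoint.sq_card_le {c : Plane} {Q : Finset Plane} (hc : IsCenterpoint c Q)
    {b n : Plane} (hb : ∀ x ∈ Q, inner ℝ n b < inner ℝ n x) :
    Q.card ^ 2 ≤ 144 * ((Q ×ˢ Q).filter fun x => ¬ Visible (segment ℝ c b) x.1 x.2).card := by
  rcases Q.eq_empty_or_nonempty with rfl | hQ
  · simp
  have hM : (0 : ℝ) < Q.card := Nat.cast_pos.2 hQ.card_pos
  obtain ⟨x₀, hx₀⟩ := hQ
  have hn0 : n ≠ 0 := by
    rintro rfl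
    simpa using hb x₀ hx₀
  -- Otherwise the half-plane through `c` with normal `-n` would contain no point of `Q`.
  have hbc : inner ℝ n b < inner ℝ n c := by
    by_contra! hcon
    have h := hc ⟨-n, inner ℝ (-n) c, neg_ne_zero.2 hn0⟩ (le_refl (inner ℝ (-n) c))
    rw [Finset.filter_eq_empty_iff.2] at h
    · simp only [Finset.card_empty, Nat.cast_zero] at h
      linarith
    · intro x hx hx'
      have hx'' : inner ℝ (-n) c ≤ inner ℝ (-n) x := hx'
      rw [inner_neg_left, inner_neg_left] at hx''
      have := hb x hx
      linarith
  have hne : b 0 - c 0 ≠ 0 ∨ b 1 - c 1 ≠ 0 := by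
    by_contra! hcon
    rw [inner_eq_coords, inner_eq_coords, sub_eq_zero.1 hcon.1, sub_eq_zero.1 hcon.2] at hbc
    exact lt_irrefl _ hbc
  set N := (Q ×ˢ Q).filter fun x => ¬ Visible (segment ℝ c b) x.1 x.2 with hN
  set Z := Q.filter fun x => cross c b x = 0 ∧ 0 ≤ along c b x with hZ
  set R := Q.filter fun x => 0 < cross c b x with hR
  set L := Q.filter fun x => cross c b x < 0 with hL
  set f : Plane → ℝ := fun x => along c b x / cross c b x with hf
  have hcount : ∀ s : ℝ, (Q.card : ℝ) / 3 ≤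
      (R.filter (s ≤ f ·)).card + (L.filter (f · ≤ s)).card + Z.card := by
    intro s
    -- This normal makes the half-plane through `c` equal to `along c b x ≥ s * cross c b x`.
    -- Dividing by `cross` turns this into `s ≤ f x` on `R` and `f x ≤ s` on `L`.
    have hns : !₂[(b 0 - c 0) + s * (b 1 - c 1), (b 1 - c 1) - s * (b 0 - c 0)] ≠ (0 : Plane) := by
      intro h0
      have e0 := congrArg (fun v : Plane => v 0) h0
      have e1 := congrArg (fun v : Plane => v 1) h0
      simp at e0 e1
      have hs : 0 < 1 + s ^ 2 := by positivity
      rcases hne with h | h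
      · apply h
        have : (1 + s ^ 2) * (b 0 - c 0) = 0 := by linear_combination e0 - s * e1
        exact (mul_eq_zero.1 this).resolve_left hs.ne'
      · apply h
        have : (1 + s ^ 2) * (b 1 - c 1) = 0 := by linear_combination e1 + s * e0
        exact (mul_eq_zero.1 this).resolve_left hs.ne'
    refine (hc ⟨_, inner ℝ _ c, hns⟩ (le_refl (inner ℝ _ c))).trans ?_
    refine le_trans (Nat.cast_le.2 (Finset.card_le_card (t := R.filter (s ≤ f ·) ∪
      L.filter (f · ≤ s) ∪ Z) fun x hx => ?_)) ?_
    · obtain ⟨hxQ, hx⟩ := Finset.mem_filter.1 hx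
      have hx' : 0 ≤ along c b x - s * cross c b x := by
        have h := hx
        simp only [HalfPlane.closedSide, Set.mem_ofPred_eq, inner_eq_coords] at h
        simp at h
        unfold along cross
        linarith
      simp only [Finset.mem_union, hR, hL, hZ, Finset.mem_filter, hf]
      rcases lt_trichotomy (cross c b x) 0 with h | h | h
      · refine Or.inl (Or.inr ⟨⟨hxQ, h⟩, ?_⟩)
        rw [div_le_iff_of_neg h]
        linarith
      · exact Or.inr ⟨hxQ, h, by simpa [h] using hx'⟩
      · refine Or.inl (Or.inl ⟨⟨hxQ, h⟩, ?_⟩)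
        rw [le_div_iff₀ h]
        linarith
    · have h1 := Finset.card_union_le (R.filter (s ≤ f ·) ∪ L.filter (f · ≤ s)) Z
      have h2 := Finset.card_union_le (R.filter (s ≤ f ·)) (L.filter (f · ≤ s))
      exact_mod_cast h1.trans (Nat.add_le_add_right h2 _)
  have hgoal : (Q.card : ℝ) ^ 2 ≤ 144 * N.card := by
    -- Either the points on the segment itself make up a sixth of `Q` and block every pair they
    -- belong to, or each threshold keeps a sixth in `R` and `L`, and `4 * 6 ^ 2 = 144`.
    rcases le_or_gt ((Q.card : ℝ) / 6) Z.card with hz | hz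
    · have hsub : Z ×ˢ Q ⊆ N := by
        intro x hx
        obtain ⟨hx1, hx2⟩ := Finset.mem_product.1 hx
        obtain ⟨hx1Q, h0, h1⟩ := Finset.mem_filter.1 hx1
        refine Finset.mem_filter.2 ⟨Finset.mem_product.2 ⟨hx1Q, hx2⟩, Set.not_disjoint_iff.2 ?_⟩
        exact ⟨x.1, left_mem_segment ℝ _ _,
          mem_segment_of_cross_eq_zero hbc (hb _ hx1Q) h0 h1⟩
      have h := Finset.card_le_card hsub
      rw [Finset.card_product] at h
      have h' : (Z.card : ℝ) * Q.card ≤ N.card := by exact_mod_cast h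
      nlinarith
    · have hsub : ((R ×ˢ L).filter fun x => f x.2 ≤ f x.1) ⊆ N := by
        intro x hx
        obtain ⟨hx, hxf⟩ := Finset.mem_filter.1 hx
        obtain ⟨hx1, hx2⟩ := Finset.mem_product.1 hx
        obtain ⟨hx1Q, hx1⟩ := Finset.mem_filter.1 hx1
        obtain ⟨hx2Q, hx2⟩ := Finset.mem_filter.1 hx2
        exact Finset.mem_filter.2 ⟨Finset.mem_product.2 ⟨hx1Q, hx2Q⟩, Set.not_disjoint_iff.2
          (segments_meet hbc (hb _ hx1Q) (hb _ hx2Q) hx1 hx2 hxf)⟩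
      have h := sq_le_card_filter_le R L f (T := (Q.card : ℝ) / 6) (by linarith) fun s => by
        have := hcount s
        linarith
      have h' : ((((R ×ˢ L).filter fun x => f x.2 ≤ f x.1).card : ℕ) : ℝ) ≤ N.card :=
        Nat.cast_le.2 (Finset.card_le_card hsub)
      nlinarith
  exact_mod_cast hgoal

/-! ### Invariants of the algorithm. -/

/-- What the algorithm knows is correct, and nothing is forgotten. -/
structure State.Sound (P : Finset Plane) (C : Set Plane) (s : State) : Prop where
  hull : ∃ F : Set Plane, F.Finite ∧ s.inner = convexHull ℝ F
  inner_subset : s.inner ⊆ C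
  notMem_inner : ∀ p ∈ s.unclassified, p ∉ s.inner
  cover : (P : Set Plane) = ↑s.unclassified ∪ s.inside ∪ s.outside
  inside_subset : s.inside ⊆ C
  notMem_of_mem_outside : ∀ p ∈ s.outside, p ∉ C

namespace State

theorem Sound.convex {P : Finset Plane} {C : Set Plane} {s : State} (hs : s.Sound P C) :
    Convex ℝ s.inner := by
  obtain ⟨F, -, h⟩ := hs.hull
  rw [h]
  exact convex_convexHull ℝ F

theorem Sound.isCompact {P : Finset Plane} {C : Set Plane} {s : State} (hs : s.Sound P C) :
    IsCompact s.inner := by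
  obtain ⟨F, hF, h⟩ := hs.hull
  rw [h]
  exact hF.isCompact_convexHull ℝ

theorem Sound.subset {P : Finset Plane} {C : Set Plane} {s : State} (hs : s.Sound P C) :
    s.unclassified ⊆ P := by
  intro p hp
  have : p ∈ (P : Set Plane) := by
    rw [hs.cover]
    exact Or.inl (Or.inl hp)
  exact this

theorem sound_initial (P : Finset Plane) (C : Set Plane) : (initial P).Sound P C where
  hull := ⟨∅, Set.finite_empty, convexHull_empty.symm⟩
  inner_subset := Set.empty_subset _
  notMem_inner _ _ := Set.notMem_empty _
  cover := by simp [initial]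
  inside_subset := Set.empty_subset _
  notMem_of_mem_outside _ h := h.elim

theorem ask_cases {C : Set Plane} (O : SeparationOracle C) (s : State) (q : Plane) :
    (q ∈ C ∧ ask O s q = { s.expand q with queries := s.queries + 1 }) ∨
    ∃ h : HalfPlane, q ∈ h.openSide ∧ Disjoint C h.openSide ∧
      ask O s q = { s.remove h with queries := s.queries + 1 } := by
  by_cases hq : q ∈ C
  · left
    refine ⟨hq, ?_⟩
    simp [ask, O.answer_of_mem q hq]
  · right
    obtain ⟨h, hh, hqh, hCh⟩ := O.answer_of_notMem q hq
    refine ⟨h, hqh, hCh, ?_⟩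
    simp [ask, hh]

theorem inner_subset_convexHull_insert (s : State) (q : Plane) :
    s.inner ⊆ convexHull ℝ (insert q s.inner) :=
  (Set.subset_insert _ _).trans (subset_convexHull ℝ _)

theorem sound_ask {P : Finset Plane} {C : Set Plane} (hC : Convex ℝ C) (O : SeparationOracle C)
    {s : State} (hs : s.Sound P C) (q : Plane) : (ask O s q).Sound P C := by
  rcases ask_cases O s q with ⟨hq, e⟩ | ⟨h, -, hCh, e⟩
  · rw [e]
    have hsub : convexHull ℝ (insert q s.inner) ⊆ C :=
      convexHull_min (Set.insert_subset hq hs.inner_subset) hC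
    refine ⟨?_, hsub, fun p hp => (Finset.mem_filter.1 hp).2, ?_, ?_, hs.notMem_of_mem_outside⟩
    · obtain ⟨F, hF, h⟩ := hs.hull
      refine ⟨insert q F, hF.insert q, ?_⟩
      simp only [expand]
      rw [h, Set.insert_eq, convexHull_convexHull_union_right, ← Set.insert_eq]
    · rw [hs.cover]
      ext x
      simp only [expand, Set.mem_union, Finset.mem_coe, Finset.mem_filter, Set.mem_inter_iff]
      tauto
    · exact Set.union_subset hs.inside_subset (Set.inter_subset_right.trans hsub)
  · rw [e]
    refine ⟨hs.hull, hs.inner_subset, fun p hp => hs.notMem_inner p (Finset.mem_filter.1 hp).1, ?_,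
      hs.inside_subset, ?_⟩
    · rw [hs.cover]
      ext x
      simp only [remove, Set.mem_union, Finset.mem_coe, Finset.mem_filter, Set.mem_inter_iff]
      tauto
    · rintro p (hp | hp)
      · exact hs.notMem_of_mem_outside p hp
      · exact Set.disjoint_right.1 hCh hp.2

theorem inner_subset_ask {C : Set Plane} (O : SeparationOracle C) (s : State) (q : Plane) :
    s.inner ⊆ (ask O s q).inner := by
  rcases ask_cases O s q with ⟨-, e⟩ | ⟨h, -, -, e⟩
  · rw [e]
    exact inner_subset_convexHull_insert s q
  · rw [e]
    exact subset_rfl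

theorem unclassified_ask_subset {C : Set Plane} (O : SeparationOracle C) (s : State) (q : Plane) :
    (ask O s q).unclassified ⊆ s.unclassified := by
  rcases ask_cases O s q with ⟨-, e⟩ | ⟨h, -, -, e⟩ <;>
  · rw [e]
    exact Finset.filter_subset _ _

theorem queries_ask {C : Set Plane} (O : SeparationOracle C) (s : State) (q : Plane) :
    (ask O s q).queries = s.queries + 1 := by
  rcases ask_cases O s q with ⟨-, e⟩ | ⟨h, -, -, e⟩ <;> rw [e]

theorem notMem_unclassified_ask {C : Set Plane} (O : SeparationOracle C) (s : State) (q : Plane) :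
    q ∉ (ask O s q).unclassified := by
  rcases ask_cases O s q with ⟨-, e⟩ | ⟨h, hq, -, e⟩
  · rw [e]
    exact fun h => (Finset.mem_filter.1 h).2 (subset_convexHull ℝ _ (Set.mem_insert _ _))
  · rw [e]
    exact fun h' => (Finset.mem_filter.1 h').2 hq

theorem foldl_ask {P : Finset Plane} {C : Set Plane} (hC : Convex ℝ C) (O : SeparationOracle C)
    (l : List Plane) (s : State) (hs : s.Sound P C) :
    (l.foldl (ask O) s).Sound P C ∧ s.inner ⊆ (l.foldl (ask O) s).inner ∧
      (l.foldl (ask O) s).unclassified ⊆ s.unclassified ∧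
      (l.foldl (ask O) s).queries = s.queries + l.length ∧
      ∀ p ∈ l, p ∉ (l.foldl (ask O) s).unclassified := by
  induction l generalizing s with
  | nil => simp [hs]
  | cons q l ih =>
    obtain ⟨h1, h2, h3, h4, h5⟩ := ih (ask O s q) (sound_ask hC O hs q)
    refine ⟨h1, (inner_subset_ask O s q).trans h2, h3.trans (unclassified_ask_subset O s q), ?_, ?_⟩
    · rw [List.foldl_cons, h4, queries_ask, List.length_cons]
      ring
    · intro p hp
      rcases List.mem_cons.1 hp with rfl | hp
      · exact fun h => notMem_unclassified_ask O s p (h3 h)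
      · exact h5 p hp

/-! ### The potential and its decrease. -/

/-- The number of ordered pairs of unclassified points that see each other past the inner
approximation. -/
noncomputable def potential (s : State) : ℕ := (visiblePairs s.inner s.unclassified).card

theorem potential_mono {s s' : State} (hi : s.inner ⊆ s'.inner)
    (hu : s'.unclassified ⊆ s.unclassified) : s'.potential ≤ s.potential :=
  Finset.card_le_card (visiblePairs_subset hi hu)

theorem card_add_potential_le {s s' : State} (hi : s.inner ⊆ s'.inner)
    (hu : s'.unclassified ⊆ s.unclassified) {N : Finset (Plane × Plane)}
    (hN : N ⊆ visiblePairs s.inner s.unclassified)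
    (hN' : Disjoint N (visiblePairs s'.inner s'.unclassified)) :
    N.card + s'.potential ≤ s.potential := by
  unfold potential
  rw [← Finset.card_union_of_disjoint hN']
  exact Finset.card_le_card (Finset.union_subset hN (visiblePairs_subset hi hu))

theorem Sound.potential_pos {P : Finset Plane} {C : Set Plane} {s : State} (hs : s.Sound P C)
    (hU : s.unclassified.Nonempty) : 0 < s.potential :=
  hU.card_pos.trans_le (card_le_card_visiblePairs hs.notMem_inner)

end State

theorem exists_isTangent {B : Set Plane} (hB : IsCompact B) (hB0 : B.Nonempty) :
    ∃ h : HalfPlane, IsTangent B h := by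
  obtain ⟨b, hb, hmax⟩ := hB.exists_isMaxOn hB0
    (f := fun x => inner ℝ (EuclideanSpace.single 0 1 : Plane) x) (by fun_prop)
  exact ⟨⟨EuclideanSpace.single 0 1, _, by simp⟩, fun x hx => hmax hx, b, hb, rfl⟩

theorem exists_isGreedyTangent {B : Set Plane} (hB : IsCompact B) (hB0 : B.Nonempty)
    (U : Finset Plane) : ∃ h : HalfPlane, IsGreedyTangent B U h := by
  obtain ⟨h₀, hh₀⟩ := exists_isTangent hB hB0
  have hbdd : BddAbove (numBeyond U '' {h | IsTangent B h}) :=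
    ⟨U.card, by
      rintro _ ⟨h, -, rfl⟩
      exact Finset.card_filter_le _ _⟩
  obtain ⟨h, hh, e⟩ := Nat.sSup_mem (Set.Nonempty.image (numBeyond U)
    (show {h | IsTangent B h}.Nonempty from ⟨h₀, hh₀⟩)) hbdd
  exact ⟨h, hh, fun h' hh' => e ▸ le_csSup hbdd ⟨h', hh', rfl⟩⟩

theorem exists_round (k : ℕ) {P : Finset Plane} {C : Set Plane} (O : SeparationOracle C)
    {s : State} (hs : s.Sound P C) (hU : s.unclassified.Nonempty) : ∃ s', Round k O s s' := by
  obtain ⟨Q, hQ⟩ : ∃ Q, IsRoundSet s Q := by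
    rcases s.inner.eq_empty_or_nonempty with h | h
    · exact ⟨_, Or.inl ⟨h, rfl⟩⟩
    · obtain ⟨t, ht⟩ := exists_isGreedyTangent hs.isCompact h s.unclassified
      exact ⟨_, Or.inr ⟨h, t, ht, rfl⟩⟩
  rcases le_or_gt Q.card k with hk | hk
  · exact ⟨_, Round.small s Q Q.toList hU hQ hk Q.nodup_toList fun p => Finset.mem_toList⟩
  · obtain ⟨c, hc⟩ := exists_isCenterpoint Q
    exact ⟨_, Round.large s Q c hU hQ hk hc⟩

/-- The points worked on in a round see each other, and there are many of them compared to the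
number of pairs that see each other. -/
theorem IsRoundSet.spec {P : Finset Plane} {C : Set Plane} {s : State} (hs : s.Sound P C)
    {Q : Finset Plane} (hQ : IsRoundSet s Q) :
    Q ×ˢ Q ⊆ visiblePairs s.inner s.unclassified ∧
    s.potential ≤ 16 * (index P + 1) * Q.card ^ 2 ∧
    (s.inner.Nonempty → ∃ b ∈ s.inner, ∃ n : Plane, ∀ x ∈ Q, inner ℝ n b < inner ℝ n x) := by
  rcases hQ with ⟨h0, rfl⟩ | ⟨h0, h, hh, rfl⟩
  · refine ⟨fun x hx => ?_, ?_, fun h => absurd h0 h.ne_empty⟩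
    · refine Finset.mem_filter.2 ⟨hx, ?_⟩
      rw [h0]
      exact Set.disjoint_empty _
    · have h1 : s.potential ≤ s.unclassified.card ^ 2 := by
        rw [sq, ← Finset.card_product]
        exact Finset.card_filter_le _ _
      nlinarith [Nat.zero_le (index P * s.unclassified.card ^ 2)]
  · have hQ : s.unclassified.filter (· ∈ h.closedSide) =
        s.unclassified.filter (· ∈ h.openSide) := by
      refine Finset.filter_congr fun p hp => ⟨fun hph => ?_, fun hph => ?_⟩
      · exact mem_openSide_of_isGreedyTangent hs.convex hs.isCompact hs.notMem_inner hh hp hph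
      · have h' : h.offset < inner ℝ h.normal p := hph
        exact h'.le
    rw [hQ]
    have hM : ∀ S ⊆ s.unclassified, Disjoint (convexHull ℝ (S : Set Plane)) s.inner →
        S.card ≤ (s.unclassified.filter (· ∈ h.openSide)).card :=
      fun S hS hd => card_le_numBeyond hs.convex hs.isCompact hh hS hd
    refine ⟨fun x hx => ?_, ?_, fun _ => ?_⟩
    · obtain ⟨hx1, hx2⟩ := Finset.mem_product.1 hx
      obtain ⟨hx1, hx1'⟩ := Finset.mem_filter.1 hx1
      obtain ⟨hx2, hx2'⟩ := Finset.mem_filter.1 hx2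
      refine Finset.mem_filter.2 ⟨Finset.mem_product.2 ⟨hx1, hx2⟩, ?_⟩
      refine Set.disjoint_left.2 fun z hz hzB => ?_
      have h1 : h.offset < inner ℝ h.normal z :=
        (convex_setOf_lt_inner h.normal h.offset).segment_subset hx1' hx2' hz
      exact absurd (hh.1.1 z hzB) (not_le.2 h1)
    · have h1 := card_visiblePairs_le hs.convex hs.isCompact h0 hs.notMem_inner hM
      have h2 := card_le_mul_index hs.convex hs.isCompact h0 hs.subset hs.notMem_inner hM
      unfold State.potential
      set M := (s.unclassified.filter (· ∈ h.openSide)).card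
      have h3 := Nat.mul_le_mul_right M h2
      nlinarith [Nat.zero_le (M ^ 2)]
    · obtain ⟨b, hb, hbo⟩ := hh.1.2
      refine ⟨b, hb, h.normal, fun x hx => ?_⟩
      rw [hbo]
      exact (Finset.mem_filter.1 hx).2

theorem Round.sound {k : ℕ} {P : Finset Plane} {C : Set Plane} (hC : Convex ℝ C)
    {O : SeparationOracle C} {s s' : State} (h : Round k O s s') (hs : s.Sound P C) :
    s'.Sound P C := by
  cases h with
  | small Q l hU hQ hk hl hlQ => exact (State.foldl_ask hC O l s hs).1
  | large Q c hU hQ hk hc => exact State.sound_ask hC O hs c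

theorem Round.unclassified_nonempty {k : ℕ} {C : Set Plane} {O : SeparationOracle C}
    {s s' : State} (h : Round k O s s') : s.unclassified.Nonempty := by
  cases h <;> assumption

theorem Round.inner_subset {k : ℕ} {P : Finset Plane} {C : Set Plane} (hC : Convex ℝ C)
    {O : SeparationOracle C} {s s' : State} (h : Round k O s s') (hs : s.Sound P C) :
    s.inner ⊆ s'.inner := by
  cases h with
  | small Q l hU hQ hk hl hlQ => exact (State.foldl_ask hC O l s hs).2.1
  | large Q c hU hQ hk hc => exact State.inner_subset_ask O s c

theorem Round.queries_le {k : ℕ} {P : Finset Plane} {C : Set Plane} (hC : Convex ℝ C)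
    {O : SeparationOracle C} {s s' : State} (h : Round k O s s') (hs : s.Sound P C) :
    s'.queries ≤ s.queries + (k + 1) := by
  cases h with
  | small Q l hU hQ hk hl hlQ =>
    rw [(State.foldl_ask hC O l s hs).2.2.2.1]
    have : l.length ≤ Q.card := by
      rw [← List.toFinset_card_of_nodup hl]
      exact Finset.card_le_card fun p hp => (hlQ p).1 (List.mem_toFinset.1 hp)
    omega
  | large Q c hU hQ hk hc =>
    rw [State.queries_ask]
    omega

/-- In each round the potential drops by a constant factor, except when the inner approximation
becomes nonempty. -/
theorem Round.potential_drop {k : ℕ} {P : Finset Plane} {C : Set Plane} (hC : Convex ℝ C)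
    {O : SeparationOracle C} {s s' : State} (h : Round k O s s') (hs : s.Sound P C) :
    (s'.potential ≤ s.potential ∧ s.inner = ∅ ∧ s'.inner.Nonempty) ∨
    s.potential + 2304 * (index P + 1) * s'.potential ≤
      2304 * (index P + 1) * s.potential := by
  -- It remains in each case to find a set `N` of destroyed pairs with `|Q| ^ 2 ≤ 144 * |N|`; the
  -- factor is `2304 = 16 * 144`.
  have conclude : ∀ (Q : Finset Plane) (N : Finset (Plane × Plane)),
      s.potential ≤ 16 * (index P + 1) * Q.card ^ 2 → Q.card ^ 2 ≤ 144 * N.card →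
      N.card + s'.potential ≤ s.potential →
      s.potential + 2304 * (index P + 1) * s'.potential ≤
        2304 * (index P + 1) * s.potential := by
    intro Q N h1 h2 h3
    have h4 := Nat.mul_le_mul_left (16 * (index P + 1)) h2
    have h5 := Nat.mul_le_mul_left (2304 * (index P + 1)) h3
    linarith
  cases h with
  | small Q l hU hQ hk hl hlQ =>
    right
    obtain ⟨hvis, hpot, -⟩ := hQ.spec hs
    obtain ⟨-, hi, hu, -, hl'⟩ := State.foldl_ask hC O l s hs
    refine conclude Q (Q ×ˢ Q) hpot ?_ (State.card_add_potential_le hi hu hvis ?_)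
    · rw [Finset.card_product]
      nlinarith [Nat.zero_le (Q.card ^ 2)]
    · refine Finset.disjoint_left.2 fun x hx hx' => ?_
      exact hl' _ ((hlQ _).2 (Finset.mem_product.1 hx).1)
        (Finset.mem_product.1 (Finset.mem_filter.1 hx').1).1
  | large Q c hU hQ hk hc =>
    obtain ⟨hvis, hpot, hsep⟩ := hQ.spec hs
    have hi := State.inner_subset_ask O s c
    have hu := State.unclassified_ask_subset O s c
    rcases State.ask_cases O s c with ⟨hcC, e⟩ | ⟨h, hch, -, e⟩
    · rcases s.inner.eq_empty_or_nonempty with h0 | h0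
      · left
        refine ⟨State.potential_mono hi hu, h0, c, ?_⟩
        rw [e]
        exact subset_convexHull ℝ _ (Set.mem_insert _ _)
      · right
        obtain ⟨b, hb, n, hbn⟩ := hsep h0
        refine conclude Q _ hpot (hc.sq_card_le hbn) (State.card_add_potential_le hi hu
          ((Finset.filter_subset _ _).trans hvis) ?_)
        -- The new inner approximation contains the segment from `c` to `b`, so pairs blocked by
        -- that segment are no longer visible.
        refine Finset.disjoint_left.2 fun x hx hx' => (Finset.mem_filter.1 hx).2 ?_
        refine (Finset.mem_filter.1 hx').2.anti ?_
        rw [e]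
        refine (convex_convexHull ℝ _).segment_subset ?_ ?_
        · exact subset_convexHull ℝ _ (Set.mem_insert _ _)
        · exact subset_convexHull ℝ _ (Set.mem_insert_of_mem _ hb)
    · right
      refine conclude Q ((Q.filter (· ∈ h.openSide)) ×ˢ Q) hpot ?_
        (State.card_add_potential_le hi hu
          ((Finset.product_subset_product_left (Finset.filter_subset _ _)).trans hvis) ?_)
      · have := hc.card_le_of_mem_openSide hch
        rw [Finset.card_product]
        nlinarith [Nat.mul_le_mul_right Q.card this,
          Nat.zero_le ((Q.filter (· ∈ h.openSide)).card * Q.card)]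
      · refine Finset.disjoint_left.2 fun x hx hx' => ?_
        have h1 := (Finset.mem_filter.1 (Finset.mem_product.1 hx).1).2
        have h2 := (Finset.mem_product.1 (Finset.mem_filter.1 hx').1).1
        rw [e] at h2
        exact (Finset.mem_filter.1 h2).2 h1

/-! ### Termination and the query bound. -/

theorem Reachable.sound {k : ℕ} {P : Finset Plane} {C : Set Plane} (hC : Convex ℝ C)
    {O : SeparationOracle C} {s : State} (h : Reachable k O P s) : s.Sound P C := by
  induction h with
  | refl => exact State.sound_initial P C
  | tail _ hr ih => exact hr.sound hC ih

theorem not_exists_run (k : ℕ) (P : Finset Plane) {C : Set Plane} (hC : Convex ℝ C)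
    (O : SeparationOracle C) :
    ¬ ∃ run : ℕ → State, run 0 = State.initial P ∧ ∀ i, Round k O (run i) (run (i + 1)) := by
  rintro ⟨run, h0, hrun⟩
  have hs : ∀ i, (run i).Sound P C := by
    intro i
    induction i with
    | zero =>
      rw [h0]
      exact State.sound_initial P C
    | succ i ih => exact (hrun i).sound hC ih
  -- The extra unit pays for the one round that may leave the potential unchanged.
  refine not_strictAnti_of_wellFoundedLT
    (fun i => (run i).potential + if (run i).inner = ∅ then 1 else 0)
    (strictAnti_nat_of_succ_lt fun i => ?_)
  have hpos := (hs i).potential_pos (hrun i).unclassified_nonempty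
  have hsub := (hrun i).inner_subset hC (hs i)
  rcases (hrun i).potential_drop hC (hs i) with ⟨hle, he, hne⟩ | hdrop
  · simp only [he, hne.ne_empty, if_true, if_false]
    omega
  · have hlt : (run (i + 1)).potential < (run i).potential := by
      by_contra! hcon
      have := Nat.mul_le_mul_left (2304 * (index P + 1)) hcon
      omega
    by_cases he : (run i).inner = ∅
    · simp only [he, if_true]
      split_ifs <;> omega
    · have he' : (run (i + 1)).inner ≠ ∅ :=
        ((Set.nonempty_iff_ne_empty.2 he).mono hsub).ne_empty
      simp only [he, he', if_false]
      omega

/-- Each round costs at most `k + 1` queries, charged to the drop of `log (potential + 1)`, or to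
the final summand when `B` becomes nonempty. The shift by `1` keeps the logarithm nonnegative at
potential zero. -/
theorem Reachable.queries_le {k : ℕ} {P : Finset Plane} {C : Set Plane} (hC : Convex ℝ C)
    {O : SeparationOracle C} {s : State} (h : Reachable k O P s) :
    (s.queries : ℝ) ≤ (k + 1) * (4608 * (index P + 1) *
      (Real.log ((P.card : ℝ) ^ 2 + 1) - Real.log ((s.potential : ℝ) + 1)) +
        if s.inner = ∅ then 0 else 1) := by
  induction h with
  | refl =>
    have h1 : ((State.initial P).potential : ℝ) ≤ (P.card : ℝ) ^ 2 := by
      have : (State.initial P).potential ≤ P.card ^ 2 := by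
        rw [sq, ← Finset.card_product]
        exact Finset.card_filter_le _ _
      exact_mod_cast this
    have h2 := Real.log_le_log (by positivity) (add_le_add_left h1 1)
    have h3 : (0 : ℝ) ≤ Real.log ((P.card : ℝ) ^ 2 + 1) -
        Real.log (((State.initial P).potential : ℝ) + 1) := by linarith
    simp only [State.initial, if_true, Nat.cast_zero] at h3 ⊢
    positivity
  | @tail s s' hr hround ih =>
    have hs : s.Sound P C := Reachable.sound hC hr
    have hq : (s'.queries : ℝ) ≤ s.queries + (k + 1) := by
      exact_mod_cast hround.queries_le hC hs
    refine hq.trans ((add_le_add_left ih _).trans ?_)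
    have hsub := hround.inner_subset hC hs
    have hpos : (1 : ℝ) ≤ s.potential := by
      exact_mod_cast hs.potential_pos hround.unclassified_nonempty
    suffices H : 1 + (if s.inner = ∅ then (0 : ℝ) else 1) ≤ 4608 * (index P + 1) *
        (Real.log ((s.potential : ℝ) + 1) - Real.log ((s'.potential : ℝ) + 1)) +
        if s'.inner = ∅ then (0 : ℝ) else 1 by
      have := mul_le_mul_of_nonneg_left H (by positivity : (0 : ℝ) ≤ k + 1)
      linarith
    rcases hround.potential_drop hC hs with ⟨hle, he, hne⟩ | hdrop
    · have hle' : (s'.potential : ℝ) ≤ s.potential := by exact_mod_cast hle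
      have h2 := Real.log_le_log (by positivity) (add_le_add_left hle' 1)
      have h3 : (0 : ℝ) ≤ Real.log ((s.potential : ℝ) + 1) -
        Real.log ((s'.potential : ℝ) + 1) := by linarith
      simp only [he, hne.ne_empty, if_true, if_false]
      have : (0 : ℝ) ≤ 4608 * (index P + 1) * (Real.log ((s.potential : ℝ) + 1) -
        Real.log ((s'.potential : ℝ) + 1)) := by positivity
      linarith
    · have hdrop' : (s.potential : ℝ) + 2304 * (index P + 1) * s'.potential ≤
          2304 * (index P + 1) * s.potential := by exact_mod_cast hdrop
      have he : (if s.inner = ∅ then (0 : ℝ) else 1) ≤ if s'.inner = ∅ then (0 : ℝ) else 1 := by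
        by_cases h' : s.inner = ∅
        · rw [if_pos h']
          split_ifs <;> norm_num
        · rw [if_neg h', if_neg ((Set.nonempty_iff_ne_empty.2 h').mono hsub).ne_empty]
      have hlog : Real.log ((s'.potential : ℝ) + 1) - Real.log ((s.potential : ℝ) + 1) ≤
          ((s'.potential : ℝ) + 1) / (s.potential + 1) - 1 := by
        rw [← Real.log_div (by positivity) (by positivity)]
        exact Real.log_le_sub_one_of_pos (by positivity)
      -- The factor doubles from `2304` to `4608` because of the shift: `potential + 1 ≤ 2 *
      -- potential` before a round.
      have hfrac : 4608 * (index P + 1 : ℝ) *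
          (((s'.potential : ℝ) + 1) / (s.potential + 1) - 1) ≤ -1 := by
        have : 4608 * (index P + 1 : ℝ) * (((s'.potential : ℝ) + 1) / (s.potential + 1) - 1) =
            4608 * (index P + 1 : ℝ) * (s'.potential - s.potential) / (s.potential + 1) := by
          field_simp
          ring
        rw [this, div_le_iff₀ (by positivity)]
        linarith
      have := mul_le_mul_of_nonneg_left hlog
        (by positivity : (0 : ℝ) ≤ 4608 * (index P + 1 : ℝ))
      linarith

theorem Reachable.queries_le_log {k : ℕ} {P : Finset Plane} {C : Set Plane} (hC : Convex ℝ C)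
    {O : SeparationOracle C} {s : State} (h : Reachable k O P s) (hP : 2 ≤ P.card) :
    (s.queries : ℝ) ≤ (k + 1) * 13826 * (index P + 1) * Real.log P.card := by
  have hn : (2 : ℝ) ≤ P.card := by exact_mod_cast hP
  -- This absorbs the summand for the exceptional round: `13826 = 3 * 4608 + 2`.
  have hlog2 : 1 ≤ 2 * Real.log P.card := by
    have := Real.log_le_log (by norm_num) hn
    have := Real.log_two_gt_d9
    linarith
  have hlog3 : Real.log ((P.card : ℝ) ^ 2 + 1) ≤ 3 * Real.log P.card := by
    have h : (P.card : ℝ) ^ 2 + 1 ≤ (P.card : ℝ) ^ 3 := by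
      nlinarith [mul_le_mul_of_nonneg_left hn (sq_nonneg (P.card : ℝ))]
    have := Real.log_le_log (by positivity) h
    rwa [Real.log_pow, Nat.cast_ofNat] at this
  have hpot : 0 ≤ Real.log ((s.potential : ℝ) + 1) := Real.log_nonneg (by simp)
  have hif : (if s.inner = ∅ then (0 : ℝ) else 1) ≤ 1 := by split_ifs <;> norm_num
  refine (h.queries_le hC).trans ?_
  have hi : (0 : ℝ) ≤ index P := Nat.cast_nonneg _
  rw [show ((k : ℝ) + 1) * 13826 * (index P + 1) * Real.log P.card =
    (k + 1) * (13826 * (index P + 1) * Real.log P.card) by ring]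
  refine mul_le_mul_of_nonneg_left ?_ (by positivity)
  have h1 := mul_le_mul_of_nonneg_left
    (show Real.log ((P.card : ℝ) ^ 2 + 1) - Real.log ((s.potential : ℝ) + 1) ≤
      3 * Real.log P.card by linarith) (by positivity : (0 : ℝ) ≤ 4608 * (index P + 1 : ℝ))
  have h2 := mul_nonneg hi (by linarith : (0 : ℝ) ≤ Real.log P.card)
  linarith

end GreedyClassification

open GreedyClassification in
theorem mainTheorem1 (k : ℕ) :
    ∃ c : ℝ, ∀ (P : Finset Plane) (C : ConvexBody Plane) (O : SeparationOracle (C : Set Plane)),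
      -- the algorithm terminates
      (¬ ∃ run : ℕ → State, run 0 = State.initial P ∧ ∀ i, Round k O (run i) (run (i + 1))) ∧
      ∀ s : State, Reachable k O P s →
        -- it never gets stuck
        (s.unclassified.Nonempty → ∃ s' : State, Round k O s s') ∧
        -- its output is correct
        (s.unclassified = ∅ →
          s.inside = (P : Set Plane) ∩ (C : Set Plane) ∧
          s.outside = (P : Set Plane) \ (C : Set Plane)) ∧
        -- it makes few queries
        (2 ≤ P.card →
          (s.queries : ℝ) ≤ c * ((index P : ℝ) + 1) * Real.log (P.card : ℝ)) := by
  refine ⟨(k + 1) * 13826, fun P C O => ⟨not_exists_run k P C.convex O, fun s hreach => ?_⟩⟩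
  have hs := hreach.sound C.convex
  refine ⟨exists_round k O hs, fun hU => ?_, hreach.queries_le_log C.convex⟩
  have hcover := hs.cover
  rw [hU, Finset.coe_empty, Set.empty_union] at hcover
  rw [hcover]
  constructor
  · ext x
    have h1 := @hs.inside_subset x
    have h2 := hs.notMem_of_mem_outside x
    simp only [Set.mem_inter_iff, Set.mem_union]
    tauto
  · ext x
    have h1 := @hs.inside_subset x
    have h2 := hs.notMem_of_mem_outside x
    simp only [Set.mem_sdiff, Set.mem_union]
    tauto
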